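/- Games. In a concurrent game on a finite set of states $Q$, at each step both players simultaneously and independently choose an action (each according to a probability distribution depending on the finite sequence of states seen so far), and the next state is drawn from a distribution determined by the current state and the two actions. A strategy of Player A maps each non-empty finite sequence of states to a probability distribution on A's actions. It is positional if it depends only on the current (last) state. It is finite-memory if it is implemented by a finite (deterministic) automaton reading the sequence of states, the action distribution depending only on the automaton's current memory state and the current state of the game; otherwise it is infinite-memory. In the co-Büchi game with target $T\subseteq Q$, Player A wins iff $T$ is visited only finitely often. The value from $q$ of a strategy of A is the infimum over all strategies of Player B of the probability that A wins from $q$; the value of the game from $q$ for A is the supremum of these values over the strategies of A; the value for B is the infimum over the strategies of B of the supremum over the strategies of A of the winning probability of A. If both are equal, this is the value of the game from $q$. A strategy of A is optimal from $q$ if its value from $q$ is the value of the game from $q$, and uniformly optimal if it is optimal from every state. The game. The states are $q_0,q_{\bar T},q_T,q_T',\top,\bot$. From $q_{\bar T},q_T,q_T'$ the game surely returns to $q_0$; $\top$ and $\bot$ are absorbing. The target is $T=\{q_T,q_T',\bot\}$. Player A has actions $a_1,a_2,a_3$ (rows) and Player B has actions $b_1,b_2,b_3$ (columns). At $q_0$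 the outcome is given by the table $$\begin{pmatrix} q_{\bar T} & q_T' & \tfrac12\\ q_T & 1 & \tfrac12\\ c_1 & c_2 & 0\end{pmatrix}$$ where an entry which is a state leads surely to that state, and an entry $u\in\{0,\tfrac12,1\}$ leads to $\top$ with probability $u$ and to $\bot$ with probability $1-u$. Here $c_1\in\{\tfrac12,1\}$ and $c_2\in\{q_{\bar T},q_T,q_T',0,\tfrac12,1\}$ are arbitrary. Theorem. For every such choice of $c_1,c_2$: 1. Every positional strategy of Player A has value strictly below $\tfrac12$ from $q_0$. 2. More generally, every finite-memory strategy of Player A has value strictly below $\tfrac12$ from $q_0$. 3. The value of the game is $\tfrac12$ from each of $q_0,q_{\bar T},q_T,q_T'$; it is $1$ from $\top$ and $0$ from $\bot$. 4. There is an infinite-memory strategy of Player A that has value $\tfrac12$ from $q_0$ and is uniformly optimal. Hence optimal strategies exist from every state of this game, but optimal strategies from $q_0$ require infinite memory. -/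

import Mathlib

open MeasureTheory ProbabilityTheory
open scoped ENNReal

/-- A concurrent stochastic arena with states `Q` and action sets `A`, `B`: a type `D` of Nature
states, a transition function `δ` into Nature states, and a distribution on states for each
Nature state. -/
structure ConcurrentArena (Q A B : Type) where
  D : Type
  δ : Q → A → B → D
  dist : D → PMF Q

/-- The non-empty finite sequences `q₀ ⋯ qₙ` of states, indexed by the position `n` of the last
state. -/
abbrev History (Q : Type) (n : ℕ) : Type := (i : Finset.Iic n) → (fun _ : ℕ => Q) i

/-- The `i`-th state of a history. -/
def History.get {Q : Type} {n : ℕ} (h : History Q n) (i : ℕ) (hi : i ≤ n) : Q :=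
  h ⟨i, Finset.mem_Iic.mpr hi⟩

/-- The current (last) state of a history. -/
def History.last {Q : Type} {n : ℕ} (h : History Q n) : Q :=
  h.get n le_rfl

/-- The list `[q₀, …, qₙ]` of states of a history. -/
def History.toList {Q : Type} {n : ℕ} (h : History Q n) : List Q :=
  List.ofFn fun i : Fin (n + 1) => h.get i (Nat.lt_succ_iff.mp i.isLt)

/-- A strategy maps every history to a distribution over the actions `Act` of the player. -/
abbrev Strategy (Q Act : Type) : Type := (n : ℕ) → History Q n → PMF Act

/-- A positional strategy depends only on the current state. -/
def Strategy.IsPositional {Q Act : Type} (σ : Strategy Q Act) : Prop :=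
  ∀ (n m : ℕ) (h : History Q n) (h' : History Q m), h.last = h'.last → σ n h = σ m h'

/-- A finite-memory strategy is implemented by a finite automaton with set of memory states `M`,
reading the states of the history one after the other: the action distribution depends only on
the memory state reached after the history, and on the current state of the game. -/
def Strategy.IsFiniteMemory {Q Act : Type} (σ : Strategy Q Act) : Prop :=
  ∃ (M : Type) (_ : Finite M) (init : M) (update : M → Q → M) (act : M → Q → PMF Act),
    ∀ (n : ℕ) (h : History Q n), σ n h = act (h.toList.foldl update init) h.last

noncomputable section

namespace ConcurrentArena

variable {Q A B : Type} (C : ConcurrentArena Q A B)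

/-- The distribution of the next state after the history `h`. -/
def next (σ : Strategy Q A) (τ : Strategy Q B) (n : ℕ) (h : History Q n) : PMF Q :=
  (σ n h).bind fun a => (τ n h).bind fun b => C.dist (C.δ h.last a b)

variable [Finite Q] [MeasurableSpace Q] [DiscreteMeasurableSpace Q]

/-- `next`, as a Markov kernel from histories to states. -/
def stepKernel (σ : Strategy Q A) (τ : Strategy Q B) (n : ℕ) :
    Kernel (History Q n) ((fun _ : ℕ => Q) (n + 1)) :=
  Kernel.ofFunOfCountable fun h => (C.next σ τ n h).toMeasure

instance isMarkovKernel_stepKernel (σ : Strategy Q A) (τ : Strategy Q B) (n : ℕ) :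
    IsMarkovKernel (C.stepKernel σ τ n) :=
  ⟨fun h => PMF.toMeasure.isProbabilityMeasure (C.next σ τ n h)⟩

/-- The probability measure on infinite paths starting in `q`, given the two strategies. -/
def pathMeasure (σ : Strategy Q A) (τ : Strategy Q B) (q : Q) : Measure (ℕ → Q) :=
  Kernel.traj (X := fun _ => Q) (C.stepKernel σ τ) 0 (fun _ => q)

end ConcurrentArena

/-- A concurrent game: an arena together with a Borel set of infinite paths, which are the paths
winning for Player A and losing for Player B. -/
structure ConcurrentGame (Q A B : Type) [MeasurableSpace Q] where
  arena : ConcurrentArena Q A B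
  objective : Set (ℕ → Q)
  measurableSet_objective : MeasurableSet objective

namespace ConcurrentGame

variable {Q A B : Type} [Finite Q] [MeasurableSpace Q] [DiscreteMeasurableSpace Q]
  (G : ConcurrentGame Q A B)

/-- The probability that Player A wins from `q`. -/
def winProb (σ : Strategy Q A) (τ : Strategy Q B) (q : Q) : ℝ≥0∞ :=
  G.arena.pathMeasure σ τ q G.objective

/-- The value from `q` of a strategy of Player A. -/
def stratValue (σ : Strategy Q A) (q : Q) : ℝ≥0∞ :=
  ⨅ τ : Strategy Q B, G.winProb σ τ q

/-- The value of the game from `q` for Player A. -/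
def valueA (q : Q) : ℝ≥0∞ :=
  ⨆ σ : Strategy Q A, G.stratValue σ q

/-- The value of the game from `q` for Player B. -/
def valueB (q : Q) : ℝ≥0∞ :=
  ⨅ τ : Strategy Q B, ⨆ σ : Strategy Q A, G.winProb σ τ q

/-- The game has value `v` from `q`: the values for both players are equal to `v`. -/
def HasValue (q : Q) (v : ℝ≥0∞) : Prop :=
  G.valueA q = v ∧ G.valueB q = v

/-- A strategy of Player A is optimal from `q` if its value is the value of the game. -/
def IsOptimalFrom (σ : Strategy Q A) (q : Q) : Prop :=
  G.HasValue q (G.stratValue σ q)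

/-- A uniformly optimal strategy is optimal from every state. -/
def IsUniformlyOptimal (σ : Strategy Q A) : Prop :=
  ∀ q : Q, G.IsOptimalFrom σ q

end ConcurrentGame

/-- The co-Büchi objective: the paths that visit `T` only finitely often. -/
def coBuchi {Q : Type} (T : Set Q) : Set (ℕ → Q) :=
  {ρ | ∃ i : ℕ, ∀ j : ℕ, i ≤ j → ρ j ∉ T}

theorem measurableSet_coBuchi {Q : Type} [MeasurableSpace Q] [DiscreteMeasurableSpace Q]
    (T : Set Q) : MeasurableSet (coBuchi T) := by
  have h : coBuchi T = ⋃ i : ℕ, ⋂ j : ℕ, ⋂ (_ : i ≤ j), (fun ρ : ℕ → Q => ρ j) ⁻¹' Tᶜ := by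
    ext ρ
    simp [coBuchi]
  rw [h]
  exact MeasurableSet.iUnion fun i => MeasurableSet.iInter fun j => MeasurableSet.iInter fun _ =>
    measurable_pi_apply j (MeasurableSet.of_discrete)

/-- The concurrent game with the co-Büchi objective given by `T`. -/
def coBuchiGame {Q A B : Type} [MeasurableSpace Q] [DiscreteMeasurableSpace Q]
    (C : ConcurrentArena Q A B) (T : Set Q) : ConcurrentGame Q A B where
  arena := C
  objective := coBuchi T
  measurableSet_objective := measurableSet_coBuchi T

/-! The example game. -/

namespace Example

/-- The states of the game: `q0`, the three states `qTbar`, `qT`, `qT'` from which the game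
surely returns to `q0`, and the two absorbing states `top` and `bot`. -/
inductive State
  | q0
  | qTbar
  | qT
  | qT'
  | top
  | bot
  deriving DecidableEq

instance : Fintype State where
  elems := {.q0, .qTbar, .qT, .qT', .top, .bot}
  complete := by
    intro q
    cases q <;> decide

instance : MeasurableSpace State := ⊤

instance : DiscreteMeasurableSpace State := ⟨fun _ => trivial⟩

/-- The actions of Player A (the rows of the table at `q0`, from top to bottom). -/
inductive ActA
  | a1
  | a2
  | a3
  deriving DecidableEq

/-- The actions of Player B (the columns of the table at `q0`, from left to right). -/
inductive ActB
  | b1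
  | b2
  | b3
  deriving DecidableEq

/-- The outcomes in the table at `q0`: `x`, `y`, `z` lead surely to `qTbar`, `qT`, `qT'`; the
outcomes `t`, `r`, `s` are the output values `1/2`, `1`, `0`, where an output value `u` leads
to `top` with probability `u` and to `bot` with probability `1 - u`. -/
inductive Outcome
  | x
  | y
  | z
  | t
  | r
  | s
  deriving DecidableEq

/-- The Nature states: one for each outcome of the table, and one leading surely to each of
`q0`, `top`, `bot`. -/
inductive Nature
  | outcome (o : Outcome)
  | toQ0
  | toTop
  | toBot
  deriving DecidableEq

/-- The table at `q0`; its entries in the first two columns of the third row are `c₁`, `c₂`. -/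
def table (c₁ c₂ : Outcome) : ActA → ActB → Outcome
  | .a1, .b1 => .x
  | .a1, .b2 => .z
  | .a1, .b3 => .t
  | .a2, .b1 => .y
  | .a2, .b2 => .r
  | .a2, .b3 => .t
  | .a3, .b1 => c₁
  | .a3, .b2 => c₂
  | .a3, .b3 => .s

/-- The transition function. -/
def trans (c₁ c₂ : Outcome) : State → ActA → ActB → Nature
  | .q0, a, b => .outcome (table c₁ c₂ a b)
  | .qTbar, _, _ => .toQ0
  | .qT, _, _ => .toQ0
  | .qT', _, _ => .toQ0
  | .top, _, _ => .toTop
  | .bot, _, _ => .toBot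

/-- The distributions of the Nature states. -/
def natureDist : Nature → PMF State
  | .outcome .x => PMF.pure .qTbar
  | .outcome .y => PMF.pure .qT
  | .outcome .z => PMF.pure .qT'
  | .outcome .t => PMF.uniformOfFinset {State.top, State.bot} (Finset.insert_nonempty _ _)
  | .outcome .r => PMF.pure .top
  | .outcome .s => PMF.pure .bot
  | .toQ0 => PMF.pure .q0
  | .toTop => PMF.pure .top
  | .toBot => PMF.pure .bot

/-- The arena of the game. -/
def arena (c₁ c₂ : Outcome) : ConcurrentArena State ActA ActB where
  D := Nature
  δ := trans c₁ c₂
  dist := natureDist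

/-- The co-Büchi game: Player A wins if `qT`, `qT'` and `bot` are visited finitely often. -/
def game (c₁ c₂ : Outcome) : ConcurrentGame State ActA ActB :=
  coBuchiGame (arena c₁ c₂) {State.qT, State.qT', State.bot}

end Example

end

/-! At `q0` the column `b3` ends the game and gives A at most 1/2, so no strategy of A does better.
To reach 1/2, A may play `a3` only if the loss in column `b3` is compensated, while the first two
rows alone must avoid infinitely many visits of T.

A finite memory uses finitely many distributions at `q0`, so their nonzero probabilities of `a3` and
`a2` are bounded below by some r and ε. B knows the automaton and replies `b3` if `a3` is possible,
which leaves A at most (1 - r)/2. Otherwise B replies `b1` if `a2` is possible, which hits `qT` with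
probability at least ε, or `b2` against pure `a1`, which hits `qT'` surely. A play that is never
absorbed then visits T infinitely often almost surely, so the value is at most (1 - r)/2.

With infinite memory, A plays `a2` at time n with probability 2^-(n+2). These rates are summable, so
`qT` is visited finitely often as long as `qT'` is avoided. Reaching `qT'` at time k + 1 raises the
bound on the losing probability to 1/2 + e, with e half the rate at time k; the chance of `top` in
column `b2` pays for this. From then on A plays `a2` and `a3` with probability e each, and the bound
drops by at least e² in expectation at every visit of `q0`, which forces absorption.

All bounds are supermartingale arguments on the product of the game with a memory (`track`):
`measure_le_of_supermartingale` bounds probabilities and `ae_eventually_lt_of_drift` excludes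
infinitely many costly visits. -/

open Filter Preorder

/-! ### Expectations under discrete distributions -/

/-- The expectation of a non-negative function under a discrete distribution. -/
noncomputable def PMF.lexpect {α : Type} (p : PMF α) (f : α → ℝ≥0∞) : ℝ≥0∞ :=
  ∑' a, p a * f a

namespace PMF

variable {α β : Type}

theorem lexpect_pure (a : α) (f : α → ℝ≥0∞) : (PMF.pure a).lexpect f = f a := by
  classical
  rw [lexpect, tsum_eq_single a]
  · simp
  · intro b hb
    simp [hb]

theorem lexpect_bind (p : PMF α) (k : α → PMF β) (f : β → ℝ≥0∞) :
    (p.bind k).lexpect f = p.lexpect fun a => (k a).lexpect f := by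
  simp only [lexpect, PMF.bind_apply, ← ENNReal.tsum_mul_right, ← ENNReal.tsum_mul_left]
  rw [ENNReal.tsum_comm]
  simp only [mul_assoc]

theorem lexpect_comm (p : PMF α) (p' : PMF β) (f : α → β → ℝ≥0∞) :
    (p.lexpect fun a => p'.lexpect (f a)) = p'.lexpect fun b => p.lexpect fun a => f a b := by
  simp only [lexpect, ← ENNReal.tsum_mul_left]
  rw [ENNReal.tsum_comm]
  simp only [mul_left_comm]

theorem lexpect_const (p : PMF α) (c : ℝ≥0∞) : p.lexpect (fun _ => c) = c := by
  rw [lexpect, ENNReal.tsum_mul_right, p.tsum_coe, one_mul]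

theorem lexpect_le (p : PMF α) {f : α → ℝ≥0∞} {c : ℝ≥0∞} (h : ∀ a, p a ≠ 0 → f a ≤ c) :
    p.lexpect f ≤ c := by
  rw [← p.lexpect_const c]
  refine ENNReal.tsum_le_tsum fun a => ?_
  by_cases ha : p a = 0
  · simp [ha]
  · exact mul_le_mul_right (h a ha) _

end PMF

/-! ### Finite histories and automata reading paths -/

/-- The path that follows a history and then stays in its last state. -/
def History.extend {Q : Type} {n : ℕ} (h : History Q n) : ℕ → Q :=
  fun i => if hi : i ≤ n then h.get i hi else h.last

theorem History.extend_frestrictLe {Q : Type} (n : ℕ) (ρ : ℕ → Q) {i : ℕ} (hi : i ≤ n) :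
    History.extend (Q := Q) (frestrictLe n ρ) i = ρ i := by
  rw [History.extend, dif_pos hi]
  rfl

/-- The state reached after `n` steps along a path by an automaton with time-dependent
transitions. -/
def track {Q S : Type} (u₀ : Q → S) (u : ℕ → S → Q → S) : ℕ → (ℕ → Q) → S
  | 0, ρ => u₀ (ρ 0)
  | n + 1, ρ => u n (track u₀ u n ρ) (ρ (n + 1))

theorem track_congr {Q S : Type} (u₀ : Q → S) (u : ℕ → S → Q → S) {n : ℕ} {ρ ρ' : ℕ → Q}
    (h : ∀ i ≤ n, ρ i = ρ' i) : track u₀ u n ρ = track u₀ u n ρ' := by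
  induction n with
  | zero => simp [track, h 0 le_rfl]
  | succ n ih =>
    rw [track, track, ih fun i hi => h i (hi.trans n.le_succ), h (n + 1) le_rfl]

theorem track_extend_frestrictLe {Q S : Type} (u₀ : Q → S) (u : ℕ → S → Q → S) (n : ℕ)
    (ρ : ℕ → Q) :
    track u₀ u n (History.extend (Q := Q) (frestrictLe n ρ)) = track u₀ u n ρ :=
  track_congr u₀ u fun _ hi => History.extend_frestrictLe n ρ hi

/-- The automaton of a finite-memory strategy also reads the initial state, hence the start `upd
init`. -/
theorem foldl_toList_frestrictLe {Q M : Type} (upd : M → Q → M) (init : M) (n : ℕ) (ρ : ℕ → Q) :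
    (History.toList (Q := Q) (frestrictLe n ρ)).foldl upd init =
      track (upd init) (fun _ => upd) n ρ := by
  have key : ∀ n : ℕ, History.toList (Q := Q) (frestrictLe n ρ) =
      List.ofFn fun i : Fin (n + 1) => ρ i := fun n => rfl
  induction n with
  | zero => rw [key]; simp [track]
  | succ n ih =>
    rw [key, List.ofFn_succ_last, List.foldl_append]
    rw [key] at ih
    simpa [track] using congrArg (upd · (ρ (n + 1))) ih

/-! ### Path measures and drift inequalities -/

namespace ConcurrentArena

variable {Q A B : Type} [Finite Q] [MeasurableSpace Q] [DiscreteMeasurableSpace Q]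
  (C : ConcurrentArena Q A B) (σ : Strategy Q A) (τ : Strategy Q B) (q : Q)

instance isProbabilityMeasure_pathMeasure : IsProbabilityMeasure (C.pathMeasure σ τ q) := by
  unfold pathMeasure
  infer_instance

theorem measurable_comp_frestrictLe {β : Type} [MeasurableSpace β] (n : ℕ)
    (F : History Q n → β) : Measurable fun ρ : ℕ → Q => F (frestrictLe n ρ) :=
  (Measurable.of_discrete (f := F)).comp (measurable_frestrictLe n)

theorem measurable_comp_track {β S : Type} [MeasurableSpace β] (u₀ : Q → S) (u : ℕ → S → Q → S)
    (n : ℕ) (F : S → Q → β) : Measurable fun ρ : ℕ → Q => F (track u₀ u n ρ) (ρ n) := by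
  have h := measurable_comp_frestrictLe (Q := Q) n
    fun h : History Q n => F (track u₀ u n h.extend) h.last
  simp only [track_extend_frestrictLe] at h
  exact h

/-- The joint law of a prefix and the next state is the composition product of the prefix law with
the step kernel. -/
theorem lintegral_comp_succ (n : ℕ) (F : History Q n → Q → ℝ≥0∞) :
    ∫⁻ ρ, F (frestrictLe n ρ) (ρ (n + 1)) ∂(C.pathMeasure σ τ q) =
      ∫⁻ ρ, (C.next σ τ n (frestrictLe n ρ)).lexpect (F (frestrictLe n ρ))
        ∂(C.pathMeasure σ τ q) := by
  have hm : Measurable fun p : History Q n × Q => F p.1 p.2 := Measurable.of_discrete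
  have hk := Kernel.partialTraj_compProd_eq_map_traj (X := fun _ => Q)
    (κ := C.stepKernel σ τ) (a := 0) (b := n) (Nat.zero_le n) (x₀ := fun _ => q)
  have h1 : ∫⁻ ρ, F (frestrictLe n ρ) (ρ (n + 1)) ∂(C.pathMeasure σ τ q) =
      ∫⁻ p, F p.1 p.2 ∂((C.pathMeasure σ τ q).map fun ρ => (frestrictLe n ρ, ρ (n + 1))) := by
    rw [lintegral_map hm (by fun_prop)]
  rw [h1, pathMeasure, ← hk, Measure.lintegral_compProd hm,
    ← Kernel.traj_map_frestrictLe_apply, lintegral_map Measurable.of_discrete (by fun_prop)]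
  refine lintegral_congr fun ρ => ?_
  have := Fintype.ofFinite Q
  change ∫⁻ b, F (frestrictLe n ρ) b ∂(C.next σ τ n (frestrictLe n ρ)).toMeasure = _
  rw [lintegral_fintype, PMF.lexpect, tsum_fintype]
  refine Finset.sum_congr rfl fun b _ => ?_
  rw [PMF.toMeasure_apply_singleton _ _ (MeasurableSet.singleton b), mul_comm]

theorem lintegral_comp_zero (f : Q → ℝ≥0∞) :
    ∫⁻ ρ, f (ρ 0) ∂(C.pathMeasure σ τ q) = f q := by
  have hm : Measurable fun h : History Q 0 => f h.last := Measurable.of_discrete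
  have h1 : ∫⁻ ρ, f (ρ 0) ∂(C.pathMeasure σ τ q) =
      ∫⁻ h : History Q 0, f h.last ∂((C.pathMeasure σ τ q).map (frestrictLe 0)) := by
    rw [lintegral_map hm (by fun_prop)]
    rfl
  rw [h1, pathMeasure, Kernel.traj_map_frestrictLe_apply, Kernel.partialTraj_self,
    Kernel.id_apply, lintegral_dirac' _ hm]
  rfl

theorem ae_next_ne_zero :
    ∀ᵐ ρ ∂(C.pathMeasure σ τ q), ∀ n, C.next σ τ n (frestrictLe n ρ) (ρ (n + 1)) ≠ 0 := by
  classical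
  rw [ae_all_iff]
  intro n
  have h := C.lintegral_comp_succ σ τ q n fun h q' => if C.next σ τ n h q' = 0 then 1 else 0
  have h0 : ∀ ρ : ℕ → Q, (C.next σ τ n (frestrictLe n ρ)).lexpect
      (fun q' => if C.next σ τ n (frestrictLe n ρ) q' = 0 then (1 : ℝ≥0∞) else 0) = 0 := by
    intro ρ
    refine le_antisymm (PMF.lexpect_le _ fun a ha => ?_) zero_le
    simp [ha]
  simp only [h0, lintegral_zero] at h
  rw [lintegral_eq_zero_iff] at h
  · filter_upwards [h] with ρ hρ h'
    simp [h'] at hρ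
  · exact measurable_comp_frestrictLe (Q := Q) (n + 1) fun h : History Q (n + 1) =>
      if C.next σ τ n (fun i => h.get i ((Finset.mem_Iic.mp i.2).trans n.le_succ)) h.last = 0
      then (1 : ℝ≥0∞) else 0

variable {S : Type} {u₀ : Q → S} {u : ℕ → S → Q → S} {g d : ℕ → S → Q → ℝ≥0∞}

/-- Taking expectations in `H` and telescoping: the total expected drift is paid for by the initial
potential. -/
theorem lintegral_add_sum_le_of_drift
    (H : ∀ n (ρ : ℕ → Q), (C.next σ τ n (frestrictLe n ρ)).lexpect
      (fun q' => g (n + 1) (u n (track u₀ u n ρ) q') q') + d n (track u₀ u n ρ) (ρ n) ≤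
        g n (track u₀ u n ρ) (ρ n)) (N : ℕ) :
    ∫⁻ ρ, g N (track u₀ u N ρ) (ρ N) ∂(C.pathMeasure σ τ q) +
      ∑ n ∈ Finset.range N, ∫⁻ ρ, d n (track u₀ u n ρ) (ρ n) ∂(C.pathMeasure σ τ q) ≤
        g 0 (u₀ q) q := by
  induction N with
  | zero =>
    simp only [track, Finset.range_zero, Finset.sum_empty, add_zero]
    rw [C.lintegral_comp_zero σ τ q fun q' => g 0 (u₀ q') q']
  | succ N ih =>
    refine le_trans ?_ ih
    rw [Finset.sum_range_succ, add_comm (Finset.sum _ _), ← add_assoc]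
    refine add_le_add_left ?_ _
    have h := C.lintegral_comp_succ σ τ q N fun h q' =>
      g (N + 1) (u N (track u₀ u N h.extend) q') q'
    simp only [track_extend_frestrictLe] at h
    simp only [track]
    rw [h, ← lintegral_add_right _ (measurable_comp_track u₀ u N (d N))]
    exact lintegral_mono fun ρ => H N ρ

/-- The drifts have a finite expected sum, so they are almost surely summable and tend to 0. If d is
a positive constant on some event, that event occurs only finitely often. -/
theorem ae_eventually_lt_of_drift
    (H : ∀ n (ρ : ℕ → Q), (C.next σ τ n (frestrictLe n ρ)).lexpect
      (fun q' => g (n + 1) (u n (track u₀ u n ρ) q') q') + d n (track u₀ u n ρ) (ρ n) ≤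
        g n (track u₀ u n ρ) (ρ n)) (h0 : g 0 (u₀ q) q ≠ ∞) :
    ∀ᵐ ρ ∂(C.pathMeasure σ τ q), ∀ c : ℝ≥0∞, c ≠ 0 →
      ∀ᶠ n in atTop, d n (track u₀ u n ρ) (ρ n) < c := by
  have hm n := measurable_comp_track (Q := Q) u₀ u n (d n)
  have hsum : ∫⁻ ρ, ∑' n, d n (track u₀ u n ρ) (ρ n) ∂(C.pathMeasure σ τ q) ≠ ∞ := by
    rw [lintegral_tsum fun n => (hm n).aemeasurable]
    refine ne_top_of_le_ne_top h0 (ENNReal.tsum_le_of_sum_range_le fun N => ?_)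
    exact le_add_self.trans (C.lintegral_add_sum_le_of_drift σ τ q H N)
  filter_upwards [ae_lt_top (Measurable.tsum hm) hsum] with ρ hρ c hc
  exact (ENNReal.tendsto_atTop_zero_of_tsum_ne_top hρ.ne).eventually_lt_const
    (pos_iff_ne_zero.mpr hc)

/-- Fatou's lemma: the indicator of `E` is almost surely at most the liminf of the potentials, whose
expectations never exceed the initial potential. No convergence theorem is needed. -/
theorem measure_le_of_supermartingale
    (H : ∀ n (ρ : ℕ → Q), (C.next σ τ n (frestrictLe n ρ)).lexpect
      (fun q' => g (n + 1) (u n (track u₀ u n ρ) q') q') ≤ g n (track u₀ u n ρ) (ρ n))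
    {E : Set (ℕ → Q)} (hE : MeasurableSet E)
    (h : ∀ᵐ ρ ∂(C.pathMeasure σ τ q), ρ ∈ E → ∀ᶠ n in atTop, 1 ≤ g n (track u₀ u n ρ) (ρ n)) :
    C.pathMeasure σ τ q E ≤ g 0 (u₀ q) q := by
  calc C.pathMeasure σ τ q E = ∫⁻ ρ, E.indicator 1 ρ ∂(C.pathMeasure σ τ q) :=
        (lintegral_indicator_one hE).symm
    _ ≤ ∫⁻ ρ, liminf (fun n => g n (track u₀ u n ρ) (ρ n)) atTop ∂(C.pathMeasure σ τ q) := by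
        refine lintegral_mono_ae ?_
        filter_upwards [h] with ρ hρ
        by_cases hρE : ρ ∈ E
        · simpa [hρE] using le_liminf_of_le (by isBoundedDefault) (hρ hρE)
        · simp [hρE]
    _ ≤ liminf (fun n => ∫⁻ ρ, g n (track u₀ u n ρ) (ρ n) ∂(C.pathMeasure σ τ q)) atTop :=
        lintegral_liminf_le fun n => measurable_comp_track u₀ u n (g n)
    _ ≤ g 0 (u₀ q) q := by
        refine liminf_le_of_le (by isBoundedDefault) fun b hb => ?_
        obtain ⟨N, hN⟩ := hb.exists
        refine hN.trans ?_
        have := C.lintegral_add_sum_le_of_drift σ τ q (u₀ := u₀) (u := u) (g := g)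
          (d := fun _ _ _ => 0) (by simpa using H) N
        simpa using this

end ConcurrentArena

/-! ### One step of the game and absorption -/

namespace Example

theorem lexpect_actA (p : PMF ActA) (f : ActA → ℝ≥0∞) :
    p.lexpect f = p .a1 * f .a1 + p .a2 * f .a2 + p .a3 * f .a3 := by
  rw [PMF.lexpect, tsum_eq_sum (s := {.a1, .a2, .a3}) fun a ha => by cases a <;> simp at ha]
  simp [add_assoc]

theorem sum_actA (p : PMF ActA) : p .a1 + p .a2 + p .a3 = 1 := by
  simpa [lexpect_actA] using p.lexpect_const 1

/-- The expectation of `G` at the state reached after an outcome of the table. -/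
noncomputable def outcomeExpect (G : State → ℝ≥0∞) (o : Outcome) : ℝ≥0∞ :=
  (natureDist (.outcome o)).lexpect G

section

variable (G : State → ℝ≥0∞)

theorem outcomeExpect_x : outcomeExpect G .x = G .qTbar := PMF.lexpect_pure _ _

theorem outcomeExpect_y : outcomeExpect G .y = G .qT := PMF.lexpect_pure _ _

theorem outcomeExpect_z : outcomeExpect G .z = G .qT' := PMF.lexpect_pure _ _

theorem outcomeExpect_r : outcomeExpect G .r = G .top := PMF.lexpect_pure _ _

theorem outcomeExpect_s : outcomeExpect G .s = G .bot := PMF.lexpect_pure _ _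

theorem outcomeExpect_t : outcomeExpect G .t = 2⁻¹ * G .top + 2⁻¹ * G .bot := by
  rw [outcomeExpect, natureDist, PMF.lexpect,
    tsum_eq_sum (s := {State.top, State.bot}) fun a ha => by simp [ha]]
  simp

theorem outcomeExpect_le {c : ℝ≥0∞} (h : ∀ q, G q ≤ c) (o : Outcome) :
    outcomeExpect G o ≤ c :=
  PMF.lexpect_le _ fun q _ => h q

end

variable (c₁ c₂ : Outcome) (σ : Strategy State ActA) (τ : Strategy State ActB)

section next

variable {n : ℕ} {h : History State n}

theorem next_top (hq : h.last = .top) : (arena c₁ c₂).next σ τ n h = PMF.pure .top := by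
  simp [ConcurrentArena.next, arena, hq, trans, natureDist]

theorem next_bot (hq : h.last = .bot) : (arena c₁ c₂).next σ τ n h = PMF.pure .bot := by
  simp [ConcurrentArena.next, arena, hq, trans, natureDist]

/-- The states from which the game surely returns to `q0`. -/
def State.IsTransient (q : State) : Prop := q = .qTbar ∨ q = .qT ∨ q = .qT'

theorem next_transient (hq : h.last.IsTransient) :
    (arena c₁ c₂).next σ τ n h = PMF.pure .q0 := by
  rcases hq with hq | hq | hq <;> simp [ConcurrentArena.next, arena, hq, trans, natureDist]

/-- The average over B's action is put outermost, so that an upper bound need only be checked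
against pure replies. -/
theorem lexpect_next_q0 (hq : h.last = .q0) (G : State → ℝ≥0∞) :
    ((arena c₁ c₂).next σ τ n h).lexpect G =
      (τ n h).lexpect fun b => (σ n h).lexpect fun a => outcomeExpect G (table c₁ c₂ a b) := by
  simp only [ConcurrentArena.next, arena, hq, trans, PMF.lexpect_bind]
  rw [PMF.lexpect_comm]
  rfl

/-- To bound the expectation of the next state from all states, it suffices to bound it at `q0`
for every pure action of Player B, and at the other states. -/
theorem lexpect_next_le {G : State → ℝ≥0∞} {c : State → ℝ≥0∞}
    (h_top : h.last = .top → G .top ≤ c .top) (h_bot : h.last = .bot → G .bot ≤ c .bot)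
    (h_tr : h.last.IsTransient → G .q0 ≤ c h.last)
    (h_q0 : h.last = .q0 → ∀ b, τ n h b ≠ 0 →
      ((σ n h).lexpect fun a => outcomeExpect G (table c₁ c₂ a b)) ≤ c .q0) :
    ((arena c₁ c₂).next σ τ n h).lexpect G ≤ c h.last := by
  have tr (hq : h.last.IsTransient) :
      ((arena c₁ c₂).next σ τ n h).lexpect G ≤ c h.last := by
    rw [next_transient _ _ _ _ hq, PMF.lexpect_pure]
    exact h_tr hq
  rcases hq : h.last with _ | _ | _ | _ | _ | _
  · rw [lexpect_next_q0 _ _ _ _ hq]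
    exact PMF.lexpect_le _ (h_q0 hq)
  · exact hq ▸ tr (.inl hq)
  · exact hq ▸ tr (.inr (.inl hq))
  · exact hq ▸ tr (.inr (.inr hq))
  · rw [next_top _ _ _ _ hq, PMF.lexpect_pure]
    exact h_top hq
  · rw [next_bot _ _ _ _ hq, PMF.lexpect_pure]
    exact h_bot hq

end next

/-- Almost every path either is absorbed in `top` or `bot`, or stays away from both and visits
`q0` infinitely often. -/
theorem ae_absorbed_or_frequently_q0 (q : State) :
    ∀ᵐ ρ ∂((arena c₁ c₂).pathMeasure σ τ q), (∀ᶠ n in atTop, ρ n = .top) ∨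
      (∀ᶠ n in atTop, ρ n = .bot) ∨
        ((∀ n, ρ n ≠ .top ∧ ρ n ≠ .bot) ∧ ∃ᶠ n in atTop, ρ n = .q0) := by
  filter_upwards [(arena c₁ c₂).ae_next_ne_zero σ τ q] with ρ hρ
  have hl : ∀ n, (History.last (Q := State) (frestrictLe n ρ)) = ρ n := fun n => rfl
  have h_top : ∀ n, ρ n = .top → ρ (n + 1) = .top := fun n hn => by
    have := hρ n
    rw [next_top _ _ _ _ (by rw [hl, hn])] at this
    by_contra h
    exact this (by simp [h])
  have h_bot : ∀ n, ρ n = .bot → ρ (n + 1) = .bot := fun n hn => by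
    have := hρ n
    rw [next_bot _ _ _ _ (by rw [hl, hn])] at this
    by_contra h
    exact this (by simp [h])
  have h_tr : ∀ n, (ρ n).IsTransient → ρ (n + 1) = .q0 := fun n hn => by
    have := hρ n
    rw [next_transient _ _ _ _ (by rw [hl]; exact hn)] at this
    by_contra h
    exact this (by simp [h])
  by_cases ht : ∃ n, ρ n = .top
  · obtain ⟨N, hN⟩ := ht
    refine .inl (eventually_atTop.mpr ⟨N, fun n hn => ?_⟩)
    induction n, hn using Nat.le_induction with
    | base => exact hN
    | succ n _ ih => exact h_top n ih
  by_cases hb : ∃ n, ρ n = .bot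
  · obtain ⟨N, hN⟩ := hb
    refine .inr (.inl (eventually_atTop.mpr ⟨N, fun n hn => ?_⟩))
    induction n, hn using Nat.le_induction with
    | base => exact hN
    | succ n _ ih => exact h_bot n ih
  push Not at ht hb
  refine .inr (.inr ⟨fun n => ⟨ht n, hb n⟩, frequently_atTop.mpr fun N => ?_⟩)
  by_cases h0 : ρ N = .q0
  · exact ⟨N, le_rfl, h0⟩
  · refine ⟨N + 1, N.le_succ, h_tr N ?_⟩
    have h1 := ht N
    have h2 := hb N
    unfold State.IsTransient
    cases hN : ρ N <;> simp_all

theorem mem_coBuchi_iff {Q : Type} {T : Set Q} {ρ : ℕ → Q} :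
    ρ ∈ coBuchi T ↔ ∀ᶠ n in atTop, ρ n ∉ T := by
  rw [eventually_atTop]
  rfl

/-- The set of target states. -/
def target : Set State := {State.qT, State.qT', State.bot}

theorem winProb_eq (q : State) :
    (game c₁ c₂).winProb σ τ q = (arena c₁ c₂).pathMeasure σ τ q (coBuchi target) := rfl

theorem winProb_add_compl (q : State) :
    (game c₁ c₂).winProb σ τ q + (arena c₁ c₂).pathMeasure σ τ q (coBuchi target)ᶜ = 1 := by
  rw [winProb_eq, measure_add_measure_compl (measurableSet_coBuchi _), measure_univ]

/-! ### The upper bound 1/2 from the column `b3` -/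

/-- The function with value `t` at `top`, `b` at `bot` and `v` at all other states. -/
def potential (t b v : ℝ≥0∞) : State → ℝ≥0∞
  | .top => t
  | .bot => b
  | _ => v

theorem potential_le {t b v c : ℝ≥0∞} (ht : t ≤ c) (hb : b ≤ c) (hv : v ≤ c) (q : State) :
    potential t b v q ≤ c := by
  cases q <;> assumption

theorem lexpect_le_half {p : PMF ActA} {G : State → ℝ≥0∞} (h_top : G .top ≤ 1)
    (h_bot : G .bot = 0) :
    (p.lexpect fun a => outcomeExpect G (table c₁ c₂ a .b3)) ≤ (1 - p .a3) * 2⁻¹ := by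
  rw [lexpect_actA]
  simp only [table, outcomeExpect_t, outcomeExpect_s, h_bot, mul_zero, add_zero, ← add_mul]
  rw [← sum_actA p, ENNReal.add_sub_cancel_right (ne_top_of_le_ne_top ENNReal.one_ne_top
    (p.coe_le_one _))]
  gcongr
  simpa using mul_le_mul_right h_top 2⁻¹

/-- By always playing `b3`, Player B bounds the winning probability. -/
theorem winProb_b3_le (q : State) :
    (game c₁ c₂).winProb σ (fun _ _ => PMF.pure .b3) q ≤ potential 1 0 (1 / 2) q := by
  -- Under `b3` the game is absorbed by time 1 from `q0` and by time 2 from a transient state. The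
  -- potential can therefore be 1 at the non-absorbing states that are not reachable at time 1, and
  -- at all of them from time 2 on. Unabsorbed paths then need no separate treatment.
  let g : ℕ → Unit → State → ℝ≥0∞ := fun n _ q => potential 1 0
    (match n, q with
      | 0, _ => 1 / 2
      | 1, .q0 => 1 / 2
      | _, _ => 1) q
  have hg1 : ∀ n s q, g n s q ≤ 1 := fun n s q => by
    refine potential_le le_rfl zero_le ?_ q
    split <;> simp
  refine (arena c₁ c₂).measure_le_of_supermartingale σ _ q (S := Unit) (u₀ := fun _ => ())
    (u := fun _ _ _ => ()) (g := g) (fun n ρ => ?_) (measurableSet_coBuchi target) ?_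
  · change _ ≤ g n () (History.last (Q := State) (frestrictLe n ρ))
    have half : ((σ n (frestrictLe n ρ)).lexpect fun a =>
        outcomeExpect (g (n + 1) ()) (table c₁ c₂ a .b3)) ≤ 1 / 2 := by
      refine (lexpect_le_half c₁ c₂ (hg1 _ () _) rfl).trans ?_
      rw [one_div]
      exact mul_le_of_le_one_left' tsub_le_self
    refine lexpect_next_le c₁ c₂ σ _ (fun _ => le_rfl) (fun _ => le_rfl) (fun hq => ?_)
      fun _ b hb => ?_
    · rcases n with _ | n
      · rcases hq with hq | hq | hq <;> rw [hq] <;> exact le_rfl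
      · refine (hg1 (n + 2) () .q0).trans ?_
        rcases hq with hq | hq | hq <;> rw [hq] <;> rcases n with _ | n <;> exact le_rfl
    · have hb' : b = .b3 := by
        by_contra h
        exact hb (by simp [h])
      subst hb'
      refine half.trans ?_
      rcases n with _ | _ | n
      · exact le_rfl
      · exact le_rfl
      · change (1 : ℝ≥0∞) / 2 ≤ 1
        simp
  · filter_upwards [ae_absorbed_or_frequently_q0 c₁ c₂ σ (fun _ _ => PMF.pure .b3) q]
      with ρ hρ hwin
    replace hwin := mem_coBuchi_iff.mp hwin
    rcases hρ with hρ | hρ | ⟨hρ, -⟩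
    · filter_upwards [hρ] with n hn
      rw [hn]
      exact le_rfl
    · obtain ⟨n, hn, hn'⟩ := (hρ.and hwin).exists
      simp [hn] at hn'
    · filter_upwards [eventually_ge_atTop 2] with n hn
      obtain ⟨m, rfl⟩ := Nat.exists_eq_add_of_le' hn
      have := hρ (m + 2)
      cases h : ρ (m + 2) <;> simp_all [g, potential]

end Example

/-! ### Finite-memory strategies stay below 1/2 -/

theorem track_fst {Q S R : Type} (u₀ : Q → S) (u : ℕ → S → Q → S) (w₀ : Q → R)
    (w : ℕ → S × R → Q → R) (n : ℕ) (ρ : ℕ → Q) :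
    (track (fun q => (u₀ q, w₀ q)) (fun n s q => (u n s.1 q, w n s q)) n ρ).1 =
      track u₀ u n ρ := by
  induction n with
  | zero => rfl
  | succ n ih => rw [track, track, ih]

theorem Strategy.IsPositional.isFiniteMemory {Q Act : Type} {σ : Strategy Q Act}
    (h : σ.IsPositional) : σ.IsFiniteMemory :=
  ⟨Unit, inferInstance, (), fun _ _ => (), fun _ q => σ 0 fun _ => q,
    fun n h' => h n 0 h' _ rfl⟩

theorem exists_pos_le_of_ne_zero {M : Type} [Finite M] (f : M → ℝ≥0∞) :
    ∃ ε : ℝ≥0∞, ε ≠ 0 ∧ ε ≤ 1 ∧ ∀ m, f m ≠ 0 → ε ≤ f m := by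
  classical
  cases isEmpty_or_nonempty M
  · exact ⟨1, one_ne_zero, le_rfl, fun m => isEmptyElim m⟩
  obtain ⟨m₀, h₀⟩ := Finite.exists_min fun m => if f m = 0 then 1 else f m
  refine ⟨min 1 (if f m₀ = 0 then 1 else f m₀), ?_, min_le_left _ _, fun m hm => ?_⟩
  · split_ifs with h <;> simp [h]
  · have := h₀ m
    rw [if_neg hm] at this
    exact (min_le_right _ _).trans this

namespace Example

variable (c₁ c₂ : Outcome)

open Classical in
/-- A reply of Player B to a distribution over the actions of Player A at `q0`. -/
noncomputable def reply (p : PMF ActA) : ActB :=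
  if p .a3 ≠ 0 then .b3 else if p .a2 ≠ 0 then .b1 else .b2

theorem lexpect_reply_potential_le (p : PMF ActA) {r : ℝ≥0∞} (hr : p .a3 ≠ 0 → r ≤ p .a3) :
    (p.lexpect fun a => outcomeExpect (potential 1 0 ((1 - r) * 2⁻¹)) (table c₁ c₂ a (reply p))) ≤
      (1 - r) * 2⁻¹ := by
  unfold reply
  split_ifs with h3 h2
  · refine (lexpect_le_half c₁ c₂ le_rfl rfl).trans ?_
    gcongr
    exact hr h3
  · refine PMF.lexpect_le _ fun a ha => ?_
    cases a
    · exact (outcomeExpect_x _).le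
    · exact (outcomeExpect_y _).le
    · exact absurd ha h3
  · refine PMF.lexpect_le _ fun a ha => ?_
    cases a
    · exact (outcomeExpect_z _).le
    · exact absurd ha h2
    · exact absurd ha h3

/-- The indicator of the states that are neither absorbing nor in the target. -/
def cleanIndicator : State → ℝ≥0∞
  | .q0 => 1
  | .qTbar => 1
  | _ => 0

/-- Each reply leaves the clean states with probability at least ε: `b3` by absorption, `b1` through
`qT`, `b2` through `qT'`. -/
theorem lexpect_reply_cleanIndicator_le (p : PMF ActA) {ε : ℝ≥0∞} (hε : ε ≤ 1)
    (hp : p .a2 ≠ 0 → ε ≤ p .a2) :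
    (p.lexpect fun a => outcomeExpect cleanIndicator (table c₁ c₂ a (reply p))) + ε ≤ 1 := by
  rw [lexpect_actA]
  unfold reply
  split_ifs with h3 h2
  · simpa [table, outcomeExpect_t, outcomeExpect_s, cleanIndicator] using hε
  · rw [not_not] at h3
    have := sum_actA p
    simp only [h3, add_zero] at this
    simp only [table, outcomeExpect_x, outcomeExpect_y, cleanIndicator, h3, zero_mul, mul_zero,
      mul_one, add_zero]
    rw [← this]
    gcongr
    exact hp h2
  · rw [not_not] at h3 h2
    simpa [table, outcomeExpect_z, cleanIndicator, h3, h2] using hε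

theorem stratValue_lt_half_of_isFiniteMemory {σ : Strategy State ActA} (hσ : σ.IsFiniteMemory) :
    (game c₁ c₂).stratValue σ .q0 < 1 / 2 := by
  classical
  obtain ⟨M, _, init, upd, act, hσ⟩ := hσ
  obtain ⟨r, hr0, -, hr⟩ := exists_pos_le_of_ne_zero fun m => act m .q0 .a3
  obtain ⟨ε, hε0, hε1, hε⟩ := exists_pos_le_of_ne_zero fun m => act m .q0 .a2
  -- B simulates A's automaton. Evaluating `act` at `q0` in every state is harmless, since B's
  -- action matters only there.
  let τ : Strategy State ActB := fun n h =>
    PMF.pure (reply (act (h.toList.foldl upd init) .q0))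
  have hσρ : ∀ n (ρ : ℕ → State), σ n (frestrictLe n ρ) =
      act (track (upd init) (fun _ => upd) n ρ) (ρ n) := fun n ρ => by
    rw [hσ, foldl_toList_frestrictLe]
    rfl
  have hτρ : ∀ n (ρ : ℕ → State), τ n (frestrictLe n ρ) =
      PMF.pure (reply (act (track (upd init) (fun _ => upd) n ρ) .q0)) := fun n ρ => by
    simp only [τ]
    rw [foldl_toList_frestrictLe]
  have hclean : ∀ᵐ ρ ∂((arena c₁ c₂).pathMeasure σ τ .q0), ∀ N,
      (∃ᶠ n in atTop, ρ n = .q0) → ∃ n > N, cleanIndicator (ρ n) = 0 := by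
    rw [ae_all_iff]
    intro N
    -- The extra flag says that no unclean state has occurred after time N; up to time N it is
    -- forced to hold. The potential is the flag itself, and from time N on each visit of `q0` under
    -- the flag costs ε. Hence such visits are almost surely finite in number.
    let w : ℕ → M × Prop → State → Prop := fun n s q =>
      n + 1 ≤ N ∨ s.2 ∧ cleanIndicator q ≠ 0
    let g : ℕ → M × Prop → State → ℝ≥0∞ := fun n s _ => if n < N ∨ s.2 then 1 else 0
    let d : ℕ → M × Prop → State → ℝ≥0∞ := fun n s q =>
      if N ≤ n ∧ s.2 ∧ q = .q0 then ε else 0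
    have hg1 : ∀ n s q, g n s q ≤ 1 := fun n s q => by
      simp only [g]
      split_ifs <;> simp
    have key := (arena c₁ c₂).ae_eventually_lt_of_drift σ τ .q0 (S := M × Prop)
      (u₀ := fun q => (upd init q, True)) (u := fun n s q => (upd s.1 q, w n s q))
      (g := g) (d := d) (fun n ρ => ?_) (ne_top_of_le_ne_top ENNReal.one_ne_top (hg1 _ _ .q0))
    · filter_upwards [key] with ρ hρ hfreq
      by_contra! hcon
      have hflag : ∀ n, (track (fun q => (upd init q, True))
          (fun n s q => (upd s.1 q, w n s q)) n ρ).2 := by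
        intro n
        induction n with
        | zero => trivial
        | succ n ih =>
          by_cases hn : n + 1 ≤ N
          · exact .inl hn
          · exact .inr ⟨ih, hcon _ (not_le.mp hn)⟩
      obtain ⟨n, hn0, hn, hnN⟩ :=
        (hfreq.and_eventually ((hρ ε hε0).and (eventually_ge_atTop N))).exists
      simp only [d] at hn
      rw [if_pos ⟨hnN, hflag n, hn0⟩] at hn
      exact lt_irrefl _ hn
    · have hfst := track_fst (upd init) (fun _ => upd) (fun _ => True) w n ρ
      generalize track (fun q => (upd init q, True)) (fun n s q => (upd s.1 q, w n s q)) n ρ = s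
        at hfst ⊢
      have hle1 : ((arena c₁ c₂).next σ τ n (frestrictLe n ρ)).lexpect
          (fun q' => g (n + 1) (upd s.1 q', w n s q') q') ≤ 1 :=
        PMF.lexpect_le _ fun q _ => hg1 _ _ q
      by_cases hn : n < N
      · simpa [g, d, hn, not_le.mpr hn] using hle1
      by_cases hs : s.2
      · by_cases hq : ρ n = .q0
        · have hG : (fun q' => g (n + 1) (upd s.1 q', w n s q') q') = cleanIndicator := by
            funext q
            have h1 : ¬ (n + 1 < N) := by omega
            cases q <;> simp [g, w, h1, hn, hs, cleanIndicator]
          rw [hG, lexpect_next_q0 c₁ c₂ σ τ (h := frestrictLe n ρ) hq, hτρ, PMF.lexpect_pure, hσρ, hq]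
          simpa [g, d, hs, not_lt.mp hn] using
            lexpect_reply_cleanIndicator_le c₁ c₂ _ hε1 (hε _)
        · simpa [g, d, hq, hs] using hle1
      · refine le_trans (le_of_eq ?_) zero_le
        have h1 : ¬ (n + 1 < N) := by omega
        simp [g, d, w, hs, h1, hn, PMF.lexpect]
  -- The constant potential (1 - r)/2 suffices: winning plays end in `top` almost surely, because
  -- `hclean` excludes winning without absorption.
  have hle : (game c₁ c₂).winProb σ τ .q0 ≤ (1 - r) * 2⁻¹ := by
    refine (arena c₁ c₂).measure_le_of_supermartingale σ τ .q0 (S := M) (u₀ := upd init)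
      (u := fun _ => upd) (g := fun _ _ => potential 1 0 ((1 - r) * 2⁻¹)) (fun n ρ => ?_)
      (measurableSet_coBuchi target) ?_
    · refine lexpect_next_le c₁ c₂ σ τ (fun _ => le_rfl) (fun _ => le_rfl) (fun hq => ?_)
        fun hq b hb => ?_
      · rcases hq with hq | hq | hq <;> rw [hq] <;> exact le_rfl
      · rw [hτρ, PMF.pure_apply] at hb
        have hb' : b = reply (act (track (upd init) (fun _ => upd) n ρ) .q0) := by
          by_contra h
          exact hb (if_neg h)
        have hq' : ρ n = .q0 := hq
        rw [hb', hσρ, hq']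
        exact lexpect_reply_potential_le c₁ c₂ _ (hr _)
    · filter_upwards [hclean, ae_absorbed_or_frequently_q0 c₁ c₂ σ τ .q0] with ρ hρc hρ hwin
      replace hwin := mem_coBuchi_iff.mp hwin
      rcases hρ with hρ | hρ | ⟨hρ, hfreq⟩
      · filter_upwards [hρ] with n hn
        rw [hn]
        exact le_rfl
      · obtain ⟨n, hn, hn'⟩ := (hρ.and hwin).exists
        simp [hn] at hn'
      · obtain ⟨N, hN⟩ := eventually_atTop.mp hwin
        obtain ⟨n, hn, hc⟩ := hρc N hfreq
        have h1 := hN n hn.le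
        have h2 := hρ n
        cases h : ρ n <;> simp_all [cleanIndicator]
  refine (iInf_le _ τ).trans_lt (hle.trans_lt ?_)
  rw [one_div]
  have h1 : 1 - r < 1 := ENNReal.sub_lt_self ENNReal.one_ne_top one_ne_zero hr0
  exact ENNReal.mul_lt_of_lt_div (by rwa [ENNReal.div_self (by simp) (by simp)])

/-! ### The optimal infinite-memory strategy -/

/-- The distribution that plays `a2` with probability `x`, `a3` with probability `y`, and `a1`
otherwise. -/
noncomputable def mixed (x y : ℝ) (hx : 0 ≤ x) (hy : 0 ≤ y) (hxy : x + y ≤ 1) : PMF ActA :=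
  PMF.ofFinset
    (fun | .a1 => ENNReal.ofReal (1 - x - y) | .a2 => ENNReal.ofReal x | .a3 => ENNReal.ofReal y)
    {.a1, .a2, .a3}
    (by
      have h : (1 - x - y) + (x + y) = 1 := by ring
      simp [← ENNReal.ofReal_add hx hy,
        ← ENNReal.ofReal_add (show 0 ≤ 1 - x - y by linarith) (add_nonneg hx hy), h])
    (fun a ha => by cases a <;> simp at ha)

/-- The alternative y = 0 spares any estimate of the third row before the first visit of `qT'`, when
`a3` is not played. -/
theorem lexpect_mixed_le {x y : ℝ} (hx : 0 ≤ x) (hy : 0 ≤ y) (hxy : x + y ≤ 1)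
    {f : ActA → ℝ≥0∞} {f₁ f₂ f₃ : ℝ} (h₁ : 0 ≤ f₁) (h₂ : 0 ≤ f₂) (h₃ : 0 ≤ f₃)
    (hf₁ : f .a1 ≤ ENNReal.ofReal f₁) (hf₂ : f .a2 ≤ ENNReal.ofReal f₂)
    (hf₃ : y = 0 ∨ f .a3 ≤ ENNReal.ofReal f₃) :
    (mixed x y hx hy hxy).lexpect f ≤
      ENNReal.ofReal ((1 - x - y) * f₁ + x * f₂ + y * f₃) := by
  have hz : 0 ≤ 1 - x - y := by linarith
  rw [lexpect_actA, ENNReal.ofReal_add (by positivity) (by positivity),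
    ENNReal.ofReal_add (by positivity) (by positivity), ENNReal.ofReal_mul hz,
    ENNReal.ofReal_mul hx, ENNReal.ofReal_mul hy]
  refine add_le_add (add_le_add (mul_le_mul_right hf₁ _) (mul_le_mul_right hf₂ _)) ?_
  change ENNReal.ofReal y * f .a3 ≤ _
  rcases hf₃ with rfl | hf₃
  · simp
  · exact mul_le_mul_right hf₃ _

/-- The probability with which the optimal strategy plays `a2` at time `n`, before the first
visit of `qT'`. -/
noncomputable def rate (n : ℕ) : ℝ := (1 / 2) ^ (n + 2)

theorem rate_pos (n : ℕ) : 0 < rate n := by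
  unfold rate
  positivity

theorem two_mul_rate_succ (n : ℕ) : 2 * rate (n + 1) = rate n := by
  unfold rate
  ring

theorem rate_le (n : ℕ) : rate n ≤ 1 / 4 := by
  unfold rate
  rw [pow_add]
  have : (1 / 2 : ℝ) ^ n ≤ 1 := pow_le_one₀ (by norm_num) (by norm_num)
  linarith

/-- The behaviour of the optimal strategy at time `n`: before the first visit of `qT'`
(memory `none`) it plays `a2` with a small probability depending on `n`; if this first visit
occurred at time `k + 1` (memory `some k`), it plays `a2` and `a3` with a small probability
depending on `k`. -/
noncomputable def optimalAction (n : ℕ) : Option ℕ → PMF ActA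
  | none => mixed (rate n) 0 (rate_pos n).le le_rfl (by linarith [rate_le n])
  | some k => mixed (rate k / 2) (rate k / 2) (by linarith [rate_pos k])
      (by linarith [rate_pos k]) (by linarith [rate_le k])

theorem lexpect_optimalAction_none_le {n : ℕ} {f : ActA → ℝ≥0∞} {f₁ f₂ c : ℝ} (h₁ : 0 ≤ f₁)
    (h₂ : 0 ≤ f₂) (hf₁ : f .a1 ≤ ENNReal.ofReal f₁) (hf₂ : f .a2 ≤ ENNReal.ofReal f₂)
    (hc : (1 - rate n) * f₁ + rate n * f₂ ≤ c) :
    (optimalAction n none).lexpect f ≤ ENNReal.ofReal c :=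
  (lexpect_mixed_le (rate_pos n).le le_rfl (by linarith [rate_le n]) h₁ h₂ le_rfl hf₁ hf₂
    (.inl rfl)).trans (ENNReal.ofReal_le_ofReal (by linarith))

theorem lexpect_optimalAction_some_le {n k : ℕ} {f : ActA → ℝ≥0∞} {f₁ f₂ f₃ c : ℝ} (h₁ : 0 ≤ f₁)
    (h₂ : 0 ≤ f₂) (h₃ : 0 ≤ f₃) (hf₁ : f .a1 ≤ ENNReal.ofReal f₁)
    (hf₂ : f .a2 ≤ ENNReal.ofReal f₂) (hf₃ : f .a3 ≤ ENNReal.ofReal f₃)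
    (hc : (1 - rate k / 2 - rate k / 2) * f₁ + rate k / 2 * f₂ + rate k / 2 * f₃ ≤ c) :
    (optimalAction n (some k)).lexpect f ≤ ENNReal.ofReal c :=
  (lexpect_mixed_le (by linarith [rate_pos k]) (by linarith [rate_pos k])
    (by linarith [rate_le k]) h₁ h₂ h₃ hf₁ hf₂ (.inr hf₃)).trans (ENNReal.ofReal_le_ofReal hc)

open Classical in
/-- The update of the memory of the optimal strategy. -/
noncomputable def optimalUpdate (n : ℕ) : Option ℕ → State → Option ℕ
  | some k, _ => some k
  | none, q => if q = .qT' then some n else none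

/-- The memory of the optimal strategy. -/
noncomputable def optimalMemory (n : ℕ) (ρ : ℕ → State) : Option ℕ :=
  track (fun _ => none) optimalUpdate n ρ

theorem optimalMemory_succ (n : ℕ) (ρ : ℕ → State) :
    optimalMemory (n + 1) ρ = optimalUpdate n (optimalMemory n ρ) (ρ (n + 1)) := rfl

/-- An optimal strategy of Player A. -/
noncomputable def optimalStrategy : Strategy State ActA := fun n h =>
  optimalAction n (optimalMemory n h.extend)

theorem optimalStrategy_frestrictLe (n : ℕ) (ρ : ℕ → State) :
    optimalStrategy n (frestrictLe n ρ) = optimalAction n (optimalMemory n ρ) := by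
  rw [optimalStrategy, optimalMemory, track_extend_frestrictLe]
  rfl

/-- A bound for the probability that Player A loses, depending on the memory. -/
noncomputable def lossBound : Option ℕ → ℝ
  | none => 1 / 2
  | some k => 1 / 2 + rate k / 2

theorem lossBound_nonneg (s : Option ℕ) : 0 ≤ lossBound s := by
  cases s with
  | none => norm_num [lossBound]
  | some k => have := rate_pos k; unfold lossBound; positivity

theorem lossBound_le_one (s : Option ℕ) : lossBound s ≤ 1 := by
  cases s with
  | none => norm_num [lossBound]
  | some k => have := rate_le k; unfold lossBound; linarith

/-- The potential of the losing probability. -/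
noncomputable def lossPotential (s : Option ℕ) : State → ℝ≥0∞ :=
  potential 0 1 (ENNReal.ofReal (lossBound s))

theorem lossPotential_le_one (s : Option ℕ) (q : State) : lossPotential s q ≤ 1 :=
  potential_le zero_le le_rfl (by simpa using lossBound_le_one s) q

/-- The expected decrease of the potential at `q0`. -/
noncomputable def lossDrift : Option ℕ → ℝ
  | none => 0
  | some k => (rate k / 2) ^ 2

theorem outcomeExpect_t_le {G : State → ℝ≥0∞} (h_top : G .top = 0) (h_bot : G .bot ≤ 1) :
    outcomeExpect G .t ≤ ENNReal.ofReal (1 / 2) := by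
  rw [outcomeExpect_t, h_top, mul_zero, zero_add, one_div, ENNReal.ofReal_inv_of_pos two_pos,
    ENNReal.ofReal_ofNat]
  exact mul_le_of_le_one_right' h_bot

/-- With x the current rate, columns `b1` and `b3` give at most 1/2, and `b2` gives (1 - x)(1/2 +
x/2) = (1 - x²)/2. -/
theorem lexpect_lossPotential_none_le (n : ℕ) (b : ActB) :
    ((optimalAction n none).lexpect fun a =>
      outcomeExpect (fun q => lossPotential (optimalUpdate n none q) q) (table c₁ c₂ a b)) ≤
        ENNReal.ofReal (1 / 2) := by
  have h0 := rate_pos n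
  have h1 := rate_le n
  have ht : outcomeExpect (fun q => lossPotential (optimalUpdate n none q) q) .t ≤
      ENNReal.ofReal (1 / 2) := outcomeExpect_t_le rfl le_rfl
  cases b
  · refine lexpect_optimalAction_none_le (f₁ := 1 / 2) (f₂ := 1 / 2) (by norm_num)
      (by norm_num) ?_ ?_ (by linarith)
    · simp [table, outcomeExpect_x, lossPotential, potential, optimalUpdate, lossBound]
    · simp [table, outcomeExpect_y, lossPotential, potential, optimalUpdate, lossBound]
  · refine lexpect_optimalAction_none_le (f₁ := 1 / 2 + rate n / 2) (f₂ := 0) (by linarith)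
      le_rfl ?_ ?_ (by nlinarith)
    · simp [table, outcomeExpect_z, lossPotential, potential, optimalUpdate, lossBound]
    · simp [table, outcomeExpect_r, lossPotential, potential]
  · exact lexpect_optimalAction_none_le (f₁ := 1 / 2) (f₂ := 1 / 2) (by norm_num)
      (by norm_num) ht ht (by linarith)

/-- Put e = `rate k / 2` and L = 1/2 + e. The columns give at most L - e², L - 2e² and L - e/2. The
first uses that `c₁` loses with probability at most 1/2; in the second, `c₂` is bounded by the
trivial loss 1. The last suffices because e ≤ 1/8. -/
theorem lexpect_lossPotential_some_le (hc₁ : c₁ = .t ∨ c₁ = .r) (n k : ℕ) (b : ActB) :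
    ((optimalAction n (some k)).lexpect fun a =>
      outcomeExpect (lossPotential (some k)) (table c₁ c₂ a b)) ≤
        ENNReal.ofReal (lossBound (some k) - lossDrift (some k)) := by
  have h0 := rate_pos k
  have h1 := rate_le k
  have ht : outcomeExpect (lossPotential (some k)) .t ≤ ENNReal.ofReal (1 / 2) :=
    outcomeExpect_t_le rfl le_rfl
  have hone (o : Outcome) : outcomeExpect (lossPotential (some k)) o ≤ ENNReal.ofReal 1 := by
    rw [ENNReal.ofReal_one]
    exact outcomeExpect_le _ (lossPotential_le_one _) o
  have hb := lossBound_nonneg (some k)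
  simp only [lossDrift]
  cases b
  · refine lexpect_optimalAction_some_le (f₁ := lossBound (some k)) (f₂ := lossBound (some k))
      (f₃ := 1 / 2) hb hb (by norm_num) (outcomeExpect_x _).le (outcomeExpect_y _).le ?_ ?_
    · rcases hc₁ with rfl | rfl
      · exact ht
      · exact (outcomeExpect_r _).trans_le zero_le
    · simp only [lossBound]
      nlinarith
  · refine lexpect_optimalAction_some_le (f₁ := lossBound (some k)) (f₂ := 0)
      (f₃ := 1) hb le_rfl (by norm_num) (outcomeExpect_z _).le
      ((outcomeExpect_r _).trans_le zero_le) (hone _) ?_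
    simp only [lossBound]
    nlinarith
  · refine lexpect_optimalAction_some_le (f₁ := 1 / 2) (f₂ := 1 / 2)
      (f₃ := 1) (by norm_num) (by norm_num) (by norm_num) ht ht (hone _) ?_
    simp only [lossBound]
    nlinarith

/-- The drift of the potential of the losing probability, as a function of the state. -/
noncomputable def stateLossDrift (s : Option ℕ) : State → ℝ≥0∞
  | .q0 => ENNReal.ofReal (lossDrift s)
  | _ => 0

theorem lossDrift_le_lossBound (s : Option ℕ) : lossDrift s ≤ lossBound s := by
  cases s with
  | none => norm_num [lossDrift, lossBound]
  | some k =>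
    have h0 := rate_pos k
    have h1 := rate_le k
    simp only [lossDrift, lossBound]
    nlinarith

theorem lexpect_next_lossPotential_le (hc₁ : c₁ = .t ∨ c₁ = .r) (τ : Strategy State ActB) (n : ℕ)
    (ρ : ℕ → State) :
    ((arena c₁ c₂).next optimalStrategy τ n (frestrictLe n ρ)).lexpect
      (fun q => lossPotential (optimalUpdate n (optimalMemory n ρ) q) q) +
        stateLossDrift (optimalMemory n ρ) (ρ n) ≤ lossPotential (optimalMemory n ρ) (ρ n) := by
  have hle : stateLossDrift (optimalMemory n ρ) (ρ n) ≤ lossPotential (optimalMemory n ρ) (ρ n) := by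
    cases ρ n
    · exact ENNReal.ofReal_le_ofReal (lossDrift_le_lossBound _)
    all_goals exact zero_le
  have hne : stateLossDrift (optimalMemory n ρ) (ρ n) ≠ ∞ :=
    ne_top_of_le_ne_top ENNReal.one_ne_top (hle.trans (lossPotential_le_one _ _))
  -- Subtraction is truncated, so the drift must be finite and at most the potential before it can
  -- be moved to the right.
  refine (ENNReal.le_sub_iff_add_le_right hne hle).mp ?_
  refine lexpect_next_le c₁ c₂ _ τ (c := fun q => lossPotential (optimalMemory n ρ) q -
    stateLossDrift (optimalMemory n ρ) q) (fun _ => ?_) (fun _ => ?_) (fun hq => ?_)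
    fun hq b _ => ?_
  · exact zero_le
  · simp [lossPotential, potential, stateLossDrift]
  · have : optimalUpdate n (optimalMemory n ρ) .q0 = optimalMemory n ρ := by
      cases optimalMemory n ρ <;> simp [optimalUpdate]
    rw [this]
    rcases hq with hq | hq | hq <;> rw [hq] <;> simp [lossPotential, potential, stateLossDrift]
  · rw [optimalStrategy_frestrictLe]
    have h0 : 0 ≤ lossDrift (optimalMemory n ρ) := by
      cases optimalMemory n ρ
      · exact le_rfl
      · exact sq_nonneg _
    change _ ≤ ENNReal.ofReal _ - ENNReal.ofReal _
    rw [← ENNReal.ofReal_sub _ h0]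
    cases optimalMemory n ρ with
    | none => simpa [lossBound, lossDrift] using lexpect_lossPotential_none_le c₁ c₂ n b
    | some k => exact lexpect_lossPotential_some_le c₁ c₂ hc₁ n k b

open Classical in
/-- The indicator of `qT`, before the first visit of `qT'`. -/
noncomputable def earlyVisit (s : Option ℕ) (q : State) : ℝ≥0∞ :=
  if s = none ∧ q = .qT then 1 else 0

/-- The term `2 * rate n` is the sum of all rates from time n on. Its decrease in one step is `rate
n`, which bounds the probability that the next state is an early `qT`. The common summand on both
sides gives the form of a drift inequality. -/
theorem lexpect_next_earlyVisit_le (τ : Strategy State ActB) (n : ℕ) (ρ : ℕ → State) :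
    ((arena c₁ c₂).next optimalStrategy τ n (frestrictLe n ρ)).lexpect
      (fun q => ENNReal.ofReal (2 * rate (n + 1)) +
        earlyVisit (optimalUpdate n (optimalMemory n ρ) q) q) +
        earlyVisit (optimalMemory n ρ) (ρ n) ≤
      ENNReal.ofReal (2 * rate n) + earlyVisit (optimalMemory n ρ) (ρ n) := by
  refine add_le_add_left ?_ _
  have h0 := rate_pos n
  have h1 := rate_le n
  have hT : ENNReal.ofReal (2 * rate (n + 1)) ≤ ENNReal.ofReal (2 * rate n) := by
    rw [two_mul_rate_succ]
    exact ENNReal.ofReal_le_ofReal (by linarith)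
  refine lexpect_next_le c₁ c₂ _ τ (c := fun _ => ENNReal.ofReal (2 * rate n))
    (fun _ => ?_) (fun _ => ?_) (fun _ => ?_) fun _ b _ => ?_
  · simpa [earlyVisit] using hT
  · simpa [earlyVisit] using hT
  · simpa [earlyVisit] using hT
  rw [optimalStrategy_frestrictLe]
  cases optimalMemory n ρ with
  | some k =>
    refine PMF.lexpect_le _ fun a _ => outcomeExpect_le _ (fun q => ?_) _
    simpa [earlyVisit, optimalUpdate] using hT
  | none =>
    set G : State → ℝ≥0∞ := fun q => ENNReal.ofReal (2 * rate (n + 1)) +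
        earlyVisit (optimalUpdate n none q) q with hG
    have hGq : ∀ q, q ≠ .qT → G q = ENNReal.ofReal (rate n) := fun q hq => by
      simp [hG, earlyVisit, hq, two_mul_rate_succ]
    have ht : outcomeExpect G .t ≤ ENNReal.ofReal (rate n) := by
      rw [outcomeExpect_t, hGq _ (by simp), hGq _ (by simp), ← add_mul, ENNReal.inv_two_add_inv_two,
        one_mul]
    cases b
    · refine lexpect_optimalAction_none_le (f₁ := rate n) (f₂ := rate n + 1) h0.le
        (by linarith) ?_ ?_ (by linarith)
      · exact ((outcomeExpect_x _).trans (hGq _ (by simp))).le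
      · refine (outcomeExpect_y _).trans_le ?_
        simp [hG, earlyVisit, optimalUpdate, two_mul_rate_succ, ENNReal.ofReal_add h0.le]
    · refine lexpect_optimalAction_none_le (f₁ := rate n) (f₂ := rate n) h0.le
        h0.le ?_ ?_ (by linarith)
      · exact ((outcomeExpect_z _).trans (hGq _ (by simp))).le
      · exact ((outcomeExpect_r _).trans (hGq _ (by simp))).le
    · exact lexpect_optimalAction_none_le (f₁ := rate n) (f₂ := rate n) h0.le
        h0.le ht ht (by linarith)

/-! ### Optimality and the value of the game -/

theorem measure_loss_optimalStrategy_le (hc₁ : c₁ = .t ∨ c₁ = .r) (τ : Strategy State ActB)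
    (q : State) :
    (arena c₁ c₂).pathMeasure optimalStrategy τ q (coBuchi target)ᶜ ≤
      potential 0 1 (1 / 2) q := by
  have hq : lossPotential none q = potential 0 1 (1 / 2) q := by
    cases q <;> simp [lossPotential, lossBound, potential, ENNReal.ofReal_inv_of_pos]
  rw [← hq]
  refine (arena c₁ c₂).measure_le_of_supermartingale optimalStrategy τ q
    (u₀ := fun _ => none) (u := optimalUpdate) (g := fun _ => lossPotential)
    (fun n ρ => le_self_add.trans (lexpect_next_lossPotential_le c₁ c₂ hc₁ τ n ρ))
    (measurableSet_coBuchi target).compl ?_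
  have hloss := (arena c₁ c₂).ae_eventually_lt_of_drift optimalStrategy τ q
    (u₀ := fun _ => none) (u := optimalUpdate) (g := fun _ => lossPotential)
    (d := fun _ => stateLossDrift) (lexpect_next_lossPotential_le c₁ c₂ hc₁ τ)
    (ne_top_of_le_ne_top ENNReal.one_ne_top (lossPotential_le_one _ _))
  have hvisit := (arena c₁ c₂).ae_eventually_lt_of_drift optimalStrategy τ q
    (u₀ := fun _ => none) (u := optimalUpdate)
    (g := fun n s q => ENNReal.ofReal (2 * rate n) + earlyVisit s q)
    (d := fun _ => earlyVisit) (lexpect_next_earlyVisit_le c₁ c₂ τ) (by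
      refine ENNReal.add_ne_top.mpr ⟨ENNReal.ofReal_ne_top, ?_⟩
      unfold earlyVisit
      split_ifs <;> simp)
  filter_upwards [hloss, hvisit, ae_absorbed_or_frequently_q0 c₁ c₂ optimalStrategy τ q]
    with ρ hρl hρv hρ hlose
  change ∀ c : ℝ≥0∞, c ≠ 0 → ∀ᶠ n in atTop, stateLossDrift (optimalMemory n ρ) (ρ n) < c at hρl
  change ∀ c : ℝ≥0∞, c ≠ 0 → ∀ᶠ n in atTop, earlyVisit (optimalMemory n ρ) (ρ n) < c at hρv
  rw [Set.mem_compl_iff, mem_coBuchi_iff, not_eventually] at hlose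
  simp only [not_not] at hlose
  rcases hρ with hρ | hρ | ⟨hρ, hfreq⟩
  · obtain ⟨n, hn, hn'⟩ := (hlose.and_eventually hρ).exists
    simp [target, hn'] at hn
  · filter_upwards [hρ] with n hn
    rw [hn]
    exact le_rfl
  -- It remains to exclude losing paths that are never absorbed. If the memory becomes `some k`,
  -- each later visit of `q0` costs the same positive drift, against infinitely many visits. If it
  -- stays `none`, both `qT` and `qT'` are visited only finitely often.
  exfalso
  by_cases hmem : ∃ N k, optimalMemory N ρ = some k
  · obtain ⟨N, k, hN⟩ := hmem
    have hN' : ∀ n ≥ N, optimalMemory n ρ = some k := fun n hn => by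
      induction n, hn using Nat.le_induction with
      | base => exact hN
      | succ n _ ih => rw [optimalMemory_succ, ih]; rfl
    have hk : stateLossDrift (some k) .q0 ≠ 0 := by
      have := rate_pos k
      simp only [stateLossDrift, lossDrift, ne_eq, ENNReal.ofReal_eq_zero, not_le]
      positivity
    obtain ⟨n, hn0, hn, hnN⟩ :=
      (hfreq.and_eventually ((hρl _ hk).and (eventually_ge_atTop N))).exists
    rw [hN' n hnN, hn0] at hn
    exact lt_irrefl _ hn
  · have hnone : ∀ n, optimalMemory n ρ = none := fun n => by
      by_contra h
      obtain ⟨k, hk⟩ := Option.ne_none_iff_exists'.mp h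
      exact hmem ⟨n, k, hk⟩
    -- Time 0 is excluded because the memory ignores the initial state, which may be `qT'`.
    obtain ⟨n, hn, hnv, hn1⟩ := (hlose.and_eventually
      ((hρv 1 one_ne_zero).and (eventually_ge_atTop 1))).exists
    obtain ⟨m, rfl⟩ := Nat.exists_eq_add_of_le' hn1
    rcases hn with h | h | h
    · simp [earlyVisit, hnone, h] at hnv
    · have h' : ρ (m + 1) = .qT' := h
      have := hnone (m + 1)
      rw [optimalMemory_succ, hnone m, h'] at this
      simp [optimalUpdate] at this
    · exact (hρ (m + 1)).2 h

theorem le_winProb_optimalStrategy (hc₁ : c₁ = .t ∨ c₁ = .r) (τ : Strategy State ActB)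
    (q : State) :
    potential 1 0 (1 / 2) q ≤ (game c₁ c₂).winProb optimalStrategy τ q := by
  have h1 := winProb_add_compl c₁ c₂ optimalStrategy τ q
  have h2 := measure_loss_optimalStrategy_le c₁ c₂ hc₁ τ q
  have h3 : potential 1 0 (1 / 2) q + potential 0 1 (1 / 2) q = 1 := by
    cases q <;> simp [potential, ENNReal.inv_two_add_inv_two]
  have hne : potential 0 1 (1 / 2) q ≠ ∞ :=
    ne_top_of_le_ne_top ENNReal.one_ne_top (le_add_self.trans_eq h3)
  refine (ENNReal.add_le_add_iff_right hne).mp ?_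
  exact (h3.trans h1.symm).trans_le (add_le_add_right h2 _)

theorem stratValue_optimalStrategy (hc₁ : c₁ = .t ∨ c₁ = .r) (q : State) :
    (game c₁ c₂).stratValue optimalStrategy q = potential 1 0 (1 / 2) q :=
  le_antisymm ((iInf_le _ _).trans (winProb_b3_le c₁ c₂ optimalStrategy q))
    (le_iInf fun τ => le_winProb_optimalStrategy c₁ c₂ hc₁ τ q)

/-- The optimal strategy bounds A's value from below, constant `b3` bounds B's value from above, and
sup inf ≤ inf sup closes the chain. -/
theorem hasValue_potential (hc₁ : c₁ = .t ∨ c₁ = .r) (q : State) :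
    (game c₁ c₂).HasValue q (potential 1 0 (1 / 2) q) := by
  have hA : potential 1 0 (1 / 2) q ≤ (game c₁ c₂).valueA q := by
    rw [← stratValue_optimalStrategy c₁ c₂ hc₁ q]
    exact le_iSup (fun σ => (game c₁ c₂).stratValue σ q) optimalStrategy
  have hB : (game c₁ c₂).valueB q ≤ potential 1 0 (1 / 2) q :=
    (iInf_le _ _).trans (iSup_le fun σ => winProb_b3_le c₁ c₂ σ q)
  have hAB : (game c₁ c₂).valueA q ≤ (game c₁ c₂).valueB q := iSup_iInf_le_iInf_iSup _
  exact ⟨le_antisymm (hAB.trans hB) hA, le_antisymm hB (hA.trans hAB)⟩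

end Example

theorem mainTheorem11 (c₁ c₂ : Example.Outcome)
    (hc₁ : c₁ = Example.Outcome.t ∨ c₁ = Example.Outcome.r) :
    -- every positional strategy of Player A has value strictly below `1/2` at `q0`
    (∀ σ : Strategy Example.State Example.ActA, σ.IsPositional →
      (Example.game c₁ c₂).stratValue σ Example.State.q0 < 1 / 2) ∧
    -- and so has every finite-memory strategy
    (∀ σ : Strategy Example.State Example.ActA, σ.IsFiniteMemory →
      (Example.game c₁ c₂).stratValue σ Example.State.q0 < 1 / 2) ∧
    -- the values of the states
    (Example.game c₁ c₂).HasValue Example.State.q0 (1 / 2) ∧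
    (Example.game c₁ c₂).HasValue Example.State.qTbar (1 / 2) ∧
    (Example.game c₁ c₂).HasValue Example.State.qT (1 / 2) ∧
    (Example.game c₁ c₂).HasValue Example.State.qT' (1 / 2) ∧
    (Example.game c₁ c₂).HasValue Example.State.top 1 ∧
    (Example.game c₁ c₂).HasValue Example.State.bot 0 ∧
    -- an infinite-memory strategy achieves the value `1/2` at `q0`, and is uniformly optimal
    (∃ σ : Strategy Example.State Example.ActA, ¬ σ.IsFiniteMemory ∧
      (Example.game c₁ c₂).stratValue σ Example.State.q0 = 1 / 2 ∧
      (Example.game c₁ c₂).IsUniformlyOptimal σ) := by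
  have hfin : ∀ σ : Strategy Example.State Example.ActA, σ.IsFiniteMemory →
      (Example.game c₁ c₂).stratValue σ Example.State.q0 < 1 / 2 :=
    fun σ hσ => Example.stratValue_lt_half_of_isFiniteMemory c₁ c₂ hσ
  have hval := Example.hasValue_potential c₁ c₂ hc₁
  have hopt := Example.stratValue_optimalStrategy c₁ c₂ hc₁
  refine ⟨fun σ hσ => hfin σ hσ.isFiniteMemory, hfin, hval .q0, hval .qTbar, hval .qT, hval .qT',
    hval .top, hval .bot, Example.optimalStrategy, fun h => ?_, hopt .q0, fun q => ?_⟩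
  -- Infinite memory is forced by the value: a finite-memory strategy would fall below 1/2.
  · exact (hfin _ h).ne (hopt .q0)
  · rw [ConcurrentGame.IsOptimalFrom, hopt q]
    exact hval q
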